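/- **Setting.** A single processor has discrete speeds $0=s_0<s_1<\dots<s_k$ with powers $P_0=0$, $P_i>0$ for $i\ge 1$, such that the slopes $\Delta_i=\frac{P_i-P_{i-1}}{s_i-s_{i-1}}$ satisfy $\Delta_{i+1}=c\,\Delta_i$ for a constant $c>1$. There are $n$ jobs; job $j$ has a release time $r_j\ge 0$, a deadline $d_j>r_j$ and a volume $p_j\ge 0$. A schedule assigns to each time $t$ a job $J(t)$ (or none) and a speed index $S(t)$, piecewise constant in $t$. With recharge rate $R\ge 0$ the battery level is $E(t)=Rt-\int_0^tP_{S(u)}\,du$. A schedule is feasible for $R$ if every job is run only in $[r_j,d_j)$ and is completed, and $E(t)\ge 0$ for all $t\ge 0$. A state of the algorithm consists of $R$, a schedule, a set $\tau_1<\dots<\tau_L$ of depletion points (labelled deadlines at which $E=0$), and speed levels $\mathcal L(j,\ell)\in\{1,\dots,k\}$ for each job $j$ active in (that is, whose window meets) the depletion interval $I_\ell=[\tau_{\ell-1},\tau_\ell)$, where $1\le\ell\le L+1$, $\tau_0=0$, $\tau_{L+1}=\infty$. A schedule is *nice* if it is feasible for some recharge rate; in each depletion interval it is the greedy (Yao–Demers–Shenker)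 schedule of the work done there, average speeds being realised by two consecutive discrete speeds, the lower one first; and it is weakly EDF: list the jobs run in $I_1$, then those run in $I_2$, and so on, within each interval by the time of their first run there; then between two appearances of $j$ in this list no job with a deadline later than $d_j$ appears. It is *perfect* if in addition the speed level relation holds, where $s_{j,\ell}$ is the average speed of $j$ in $I_\ell$: 1. if $j$ is processed in $I_\ell$, then $s_{j,\ell}\in(s_{i-1},s_i)$ implies $\mathcal L(j,\ell)=i$, and $s_{j,\ell}=s_i$ implies $\mathcal L(j,\ell)\in\{i,i+1\}$; 2. for $\ell_1<\ell_2$, the difference $\mathcal L(j,\ell_2)-\mathcal L(j,\ell_1)$ is nonnegative and is the same for all jobs $j$ active in both $I_{\ell_1}$ and $I_{\ell_2}$; 3. a job that is processed at time $t\in I_\ell$ has the maximum level $\mathcal L(\cdot,\ell)$ among the jobs active at time $t$. In every state the schedule is perfect and is feasible for the current $R$. An *$\epsilon$-transfer* from $\ell_0$ to $\ell_s$ ($s\ge 1$) is a sequence of depletion intervals $\ell_0,\dots,\ell_s$ and jobs $j_1,\dots,j_s$ such that one can move, simultaneously for all $a$, a positive amount of work of $j_a$ from $\ell_{a-1}$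 to $\ell_a$, keeping the schedule nice all along the move and not changing the speeds in $\ell_1,\dots,\ell_{s-1}$. It is *active* if the schedule also stays perfect with the current levels. The *distribution graph* has the depletion intervals as vertices and the active $\epsilon$-transfers as edges. **Algorithm.** Start with the greedy schedule of the whole instance, a rate $R$ for which it is feasible, and for every job one speed level, the same in all intervals. Then perform steps of the following kinds, each of which leads to a state as above. * *Moving work.* Build a tree in the distribution graph that is rooted at $L+1$ and spans all vertices by adding, again and again, an edge of highest priority entering the current vertex set (right-going edges first, shorter ones preferred; then left-going edges, longer ones preferred). Move work along $\epsilon$-transfers that represent the tree edges while lowering $R$; the levels and the depletion points stay. * *Depletion point appearance.* A deadline at which $E=0$ is labelled as a new depletion point; levels are inherited. * *Depletion point removal.* A depletion point is removed, and levels are inherited; this requires that each job active on both sides has the same level on both sides. * *Fixing a cut.* Let $\ell_0$ be a depletion interval without a path in the distribution graph to $L+1$, but with a path to $L+1$ of (active or inactive) $\epsilon$-transfers. Let $U=\{\ell_{\min},\dots,\ell_{\max}\}$, where $\ell_{\min}$ and $\ell_{\max}$ are the minimal and the maximal vertex reachable from $\ell_0$ in the distribution graph. Only speed levels change: for each job active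 both inside and outside $U$, either all its levels in $U$ decrease by one, or all its levels outside $U$ increase by one; for every other job one of these changes may be made, or none. In the appearance and removal steps the work is rescheduled by the greedy rule between the new depletion points; the total work of each job in an interval that is split, in two merged intervals together, and in every other interval stays the same. **Lemma.** In every execution of the algorithm, whichever admissible choices it makes, the algorithm fixes a cut in the distribution graph at most $kn^2$ times. -/

import Mathlib

open MeasureTheory Set

noncomputable section

namespace Solar

/-! ## Instances and schedules -/

/-- An instance with `n` jobs and discrete speeds `0 = s_0 < s_1 < ... < s_k`, powers `P_i`. -/
structure Problem (n k : ℕ) where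
  speed : Fin (k + 1) → ℝ
  power : Fin (k + 1) → ℝ
  release : Fin n → ℝ
  deadline : Fin n → ℝ
  volume : Fin n → ℝ
  speed_zero : speed 0 = 0
  speed_strictMono : StrictMono speed
  power_zero : power 0 = 0
  power_pos : ∀ i, i ≠ 0 → 0 < power i
  /-- Well-separated speeds: the slopes of the power function grow by a constant factor. -/
  wellSeparated : ∃ c : ℝ, 1 < c ∧ ∀ i i' : Fin k, (i' : ℕ) = i + 1 →
    (power i'.succ - power i'.castSucc) / (speed i'.succ - speed i'.castSucc) =
      c * ((power i.succ - power i.castSucc) / (speed i.succ - speed i.castSucc))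
  release_nonneg : ∀ j, 0 ≤ release j
  release_lt_deadline : ∀ j, release j < deadline j
  volume_nonneg : ∀ j, 0 ≤ volume j

/-- A schedule: at each time a job (or none) and the index of a discrete speed.  Time is cut into
finitely many half-open pieces on which nothing changes. A job may be assigned while the processor
pauses (speed index `0`); this is how an average speed below `s_1` is realised. -/
structure Schedule (n k : ℕ) where
  job : ℝ → Option (Fin n)
  speedIdx : ℝ → Fin (k + 1)
  idle : ∀ t, job t = none → speedIdx t = 0
  piecewise : ∃ B : Finset ℝ, ∀ x y, x ≤ y → (∀ b ∈ B, b ∉ Ioc x y) →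
    job x = job y ∧ speedIdx x = speedIdx y

variable {n k : ℕ}

/-- The time window `[r_j, d_j)` of a job. -/
def Problem.window (P : Problem n k) (j : Fin n) : Set ℝ := Ico (P.release j) (P.deadline j)

/-- The amount of work of `j` processed during `A`. -/
def workIn (P : Problem n k) (S : Schedule n k) (j : Fin n) (A : Set ℝ) : ℝ :=
  ∫ t in A, if S.job t = some j then P.speed (S.speedIdx t) else 0

/-- The amount of time during `A` assigned to `j`. -/
def timeIn (S : Schedule n k) (j : Fin n) (A : Set ℝ) : ℝ :=
  (volume {t | t ∈ A ∧ S.job t = some j}).toReal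

/-- The average speed of `j` during `A`. -/
def avgSpeed (P : Problem n k) (S : Schedule n k) (j : Fin n) (A : Set ℝ) : ℝ :=
  workIn P S j A / timeIn S j A

/-- The energy left in the battery at time `t` when the recharge rate is `R`. -/
def energy (P : Problem n k) (R : ℝ) (S : Schedule n k) (t : ℝ) : ℝ :=
  R * t - ∫ u in (0 : ℝ)..t, P.power (S.speedIdx u)

/-- Jobs run inside their windows, all jobs are finished, the battery level is never negative. -/
structure Feasible (P : Problem n k) (R : ℝ) (S : Schedule n k) : Prop where
  window : ∀ t j, S.job t = some j → t ∈ P.window j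
  finished : ∀ j, P.volume j ≤ workIn P S j univ
  battery : ∀ t, 0 ≤ t → 0 ≤ energy P R S t

/-! ## Depletion intervals

A finite set `D` of positive times `τ_1 < ... < τ_L` cuts `[0, ∞)` into the intervals
`I_ℓ = [τ_(ℓ-1), τ_ℓ)`, `1 ≤ ℓ ≤ L + 1`, with `τ_0 = 0` and `τ_(L+1) = ∞`. -/

/-- The index of the depletion interval that contains time `t`. -/
def idx (D : Finset ℝ) (t : ℝ) : ℕ := (D.filter (fun τ => τ ≤ t)).card + 1

/-- The depletion interval `I_ℓ`. -/
def ivl (D : Finset ℝ) (ℓ : ℕ) : Set ℝ := {t | 0 ≤ t ∧ idx D t = ℓ}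

/-- Job `j` is active (alive) at some time of `I_ℓ`. -/
def ActiveIn (P : Problem n k) (D : Finset ℝ) (j : Fin n) (ℓ : ℕ) : Prop :=
  (ivl D ℓ ∩ P.window j).Nonempty

/-- Some work of `j` is processed in `I_ℓ`. -/
def Processed (P : Problem n k) (D : Finset ℝ) (S : Schedule n k) (j : Fin n) (ℓ : ℕ) : Prop :=
  0 < workIn P S j (ivl D ℓ)

/-! ## The greedy (Yao, Demers, Shenker) schedule -/

open Classical in
/-- The jobs of `rem` whose windows, restricted to the free time `A`, lie in `[a, b)`. -/
def Problem.contained (P : Problem n k) (rem : Finset (Fin n)) (A : Set ℝ) (a b : ℝ) :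
    Finset (Fin n) :=
  rem.filter (fun j => P.window j ∩ A ⊆ Ico a b)

/-- The intensity of `[a, b)`: work that has to be done there, divided by the free time. -/
def intensity (P : Problem n k) (S : Schedule n k) (I : Set ℝ) (rem : Finset (Fin n))
    (A : Set ℝ) (a b : ℝ) : ℝ :=
  (∑ j ∈ P.contained rem A a b, workIn P S j I) / (volume (A ∩ Ico a b)).toReal

/-- `GreedyYDS P S I rem A`: on the part `A` of `I` that is still free, the schedule `S` processes
the jobs `rem` as the greedy algorithm does, where the work of `j` is what `S` does of it in `I`.
An interval `[a, b)` of maximum intensity (a critical interval) is filled with the jobs that have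
to be done in it, all at average speed equal to the intensity; it is then cut out of the free time,
and the jobs are removed. -/
inductive GreedyYDS (P : Problem n k) (S : Schedule n k) (I : Set ℝ) :
    Finset (Fin n) → Set ℝ → Prop
  | done (A : Set ℝ) : (∀ t ∈ A, S.job t = none) → GreedyYDS P S I ∅ A
  | critical (rem : Finset (Fin n)) (A : Set ℝ) (a b : ℝ) :
      (P.contained rem A a b).Nonempty →
      0 < (volume (A ∩ Ico a b)).toReal →
      (∀ a' b' : ℝ, 0 < (volume (A ∩ Ico a' b')).toReal →
        intensity P S I rem A a' b' ≤ intensity P S I rem A a b) →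
      (∀ j ∈ P.contained rem A a b, avgSpeed P S j I = intensity P S I rem A a b) →
      (∀ t ∈ A ∩ Ico a b, ∃ j ∈ P.contained rem A a b, S.job t = some j) →
      GreedyYDS P S I (rem \ P.contained rem A a b) (A \ Ico a b) →
      GreedyYDS P S I rem A

open Classical in
/-- In every depletion interval the work done there is scheduled by the greedy rule. -/
def IsYDS (P : Problem n k) (D : Finset ℝ) (S : Schedule n k) : Prop :=
  ∀ ℓ ∈ Finset.Icc 1 (D.card + 1),
    GreedyYDS P S (ivl D ℓ) (Finset.univ.filter (fun j => Processed P D S j ℓ)) (ivl D ℓ)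

/-- In every depletion interval, the average speed of a job is realised by two consecutive discrete
speeds, the lower one first. -/
def Interpolated (D : Finset ℝ) (S : Schedule n k) : Prop :=
  ∀ (j : Fin n) (ℓ : ℕ), ∃ i : Fin k,
    (∀ t ∈ ivl D ℓ, S.job t = some j → S.speedIdx t = i.castSucc ∨ S.speedIdx t = i.succ) ∧
    (∀ t ∈ ivl D ℓ, ∀ u ∈ ivl D ℓ, S.job t = some j → S.job u = some j → t ≤ u →
      S.speedIdx t ≤ S.speedIdx u)

/-- `t` is the first time at which `j` is run in the depletion interval that contains `t`.
The first-run sequence lists the jobs by these times. -/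
def FirstRun (D : Finset ℝ) (S : Schedule n k) (j : Fin n) (t : ℝ) : Prop :=
  S.job t = some j ∧ ∀ u ∈ ivl D (idx D t), u < t → S.job u ≠ some j

/-- Between the first and the last appearance of `j` in the first-run sequence, no job with a later
deadline than `j` appears. -/
def WeakEDF (P : Problem n k) (D : Finset ℝ) (S : Schedule n k) : Prop :=
  ∀ (i j : Fin n) (t₁ t t₂ : ℝ), FirstRun D S j t₁ → FirstRun D S i t → FirstRun D S j t₂ →
    t₁ < t → t < t₂ → P.deadline i ≤ P.deadline j

/-- Nice schedules: feasible (for some recharge rate), greedy between depletion points, weak EDF. -/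
structure Nice (P : Problem n k) (D : Finset ℝ) (S : Schedule n k) : Prop where
  feasible : ∃ R : ℝ, 0 ≤ R ∧ Feasible P R S
  yds : IsYDS P D S
  interpolated : Interpolated D S
  weakEDF : WeakEDF P D S

/-- The speed level relation for the speed levels `lev j ℓ` (meaningful if `j` is active in `I_ℓ`). -/
structure SLR (P : Problem n k) (D : Finset ℝ) (S : Schedule n k) (lev : Fin n → ℕ → ℕ) :
    Prop where
  /-- levels are indices of discrete speeds -/
  range : ∀ j ℓ, ActiveIn P D j ℓ → 1 ≤ lev j ℓ ∧ lev j ℓ ≤ k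
  between : ∀ j ℓ, Processed P D S j ℓ → ∀ i : Fin k,
    avgSpeed P S j (ivl D ℓ) ∈ Ioo (P.speed i.castSucc) (P.speed i.succ) → lev j ℓ = i + 1
  discrete : ∀ j ℓ, Processed P D S j ℓ → ∀ i : Fin (k + 1),
    avgSpeed P S j (ivl D ℓ) = P.speed i → lev j ℓ = i ∨ lev j ℓ = i + 1
  jump : ∀ j j' ℓ₁ ℓ₂, ℓ₁ < ℓ₂ → ActiveIn P D j ℓ₁ → ActiveIn P D j ℓ₂ →
    ActiveIn P D j' ℓ₁ → ActiveIn P D j' ℓ₂ →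
    (lev j ℓ₂ : ℤ) - lev j ℓ₁ = lev j' ℓ₂ - lev j' ℓ₁ ∧ (0 : ℤ) ≤ (lev j ℓ₂ : ℤ) - lev j ℓ₁
  /-- the job that is processed has maximum level among the jobs that are active at that time -/
  top : ∀ t j j', S.job t = some j → t ∈ P.window j' → lev j' (idx D t) ≤ lev j (idx D t)

/-- Perfect schedules: nice, and the speed level relation holds. -/
def Perfect (P : Problem n k) (D : Finset ℝ) (S : Schedule n k) (lev : Fin n → ℕ → ℕ) : Prop :=
  Nice P D S ∧ SLR P D S lev

/-! ## States of the algorithm -/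

/-- What the algorithm maintains: the recharge rate, the schedule, the labelled depletion points,
and the speed levels. -/
structure State (n k : ℕ) where
  rate : ℝ
  sched : Schedule n k
  points : Finset ℝ
  lev : Fin n → ℕ → ℕ

/-- The index `L + 1` of the rightmost depletion interval. -/
def State.last (σ : State n k) : ℕ := σ.points.card + 1

/-- The schedule is feasible for the current rate and perfect; the battery is empty at the labelled
depletion points, which are deadlines. -/
structure Valid (P : Problem n k) (σ : State n k) : Prop where
  rate_nonneg : 0 ≤ σ.rate
  feasible : Feasible P σ.rate σ.sched
  perfect : Perfect P σ.points σ.sched σ.lev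
  deadlines : ∀ τ ∈ σ.points, ∃ j, P.deadline j = τ
  depleted : ∀ τ ∈ σ.points, energy P σ.rate σ.sched τ = 0

/-! ## Transfers and the distribution graph -/

/-- A sequence of depletion intervals `ℓ_0, ..., ℓ_s` with `s = len + 1 ≥ 1`, and jobs; the `a`-th
job moves from the `a`-th interval of the sequence to the next one. -/
structure Transfer (n : ℕ) where
  len : ℕ
  interval : Fin (len + 2) → ℕ
  job : Fin (len + 1) → Fin n

def Transfer.source (T : Transfer n) : ℕ := T.interval 0

def Transfer.dest (T : Transfer n) : ℕ := T.interval (Fin.last _)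

/-- The change of the workload of `j` in `I_ℓ` when the amount `w a` is moved on the `a`-th step. -/
def Transfer.net (T : Transfer n) (w : Fin (T.len + 1) → ℝ) (j : Fin n) (ℓ : ℕ) : ℝ :=
  ∑ a, if T.job a = j then
    (if T.interval a.succ = ℓ then w a else 0) - (if T.interval a.castSucc = ℓ then w a else 0)
  else 0

/-- The average speed at time `t` of the job that is run at time `t`. -/
def profile (P : Problem n k) (D : Finset ℝ) (S : Schedule n k) (t : ℝ) : ℝ :=
  match S.job t with
  | none => 0
  | some j => avgSpeed P S j (ivl D (idx D t))

/-- One can simultaneously move work along all steps of `T`, such that the schedule satisfies `Q`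
all along the move and the speeds in the intermediate intervals do not change. -/
def CanMove (P : Problem n k) (D : Finset ℝ) (S : Schedule n k) (T : Transfer n)
    (Q : Schedule n k → Prop) : Prop :=
  (∀ a, T.interval a ∈ Finset.Icc 1 (D.card + 1)) ∧
  (∀ a : Fin (T.len + 1), T.interval a.castSucc ≠ T.interval a.succ ∧
    ActiveIn P D (T.job a) (T.interval a.castSucc) ∧ ActiveIn P D (T.job a) (T.interval a.succ)) ∧
  ∃ w : Fin (T.len + 1) → ℝ,
    (∀ a, 0 < w a ∧ w a ≤ workIn P S (T.job a) (ivl D (T.interval a.castSucc))) ∧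
    ∀ θ ∈ Ioc (0 : ℝ) 1, ∃ S' : Schedule n k, Q S' ∧
      (∀ j, ∀ ℓ ∈ Finset.Icc 1 (D.card + 1), workIn P S' j (ivl D ℓ) =
        workIn P S j (ivl D ℓ) + T.net (fun a => θ * w a) j ℓ) ∧
      (∀ a, a ≠ 0 → a ≠ Fin.last _ → ∀ t ∈ ivl D (T.interval a), profile P D S' t = profile P D S t)

/-- ε-transfers: moving work along them maintains niceness. -/
def IsEpsTransfer (P : Problem n k) (σ : State n k) (T : Transfer n) : Prop :=
  CanMove P σ.points σ.sched T (Nice P σ.points)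

/-- Active ε-transfers: moving work along them maintains perfectness (with the current levels). -/
def IsActiveTransfer (P : Problem n k) (σ : State n k) (T : Transfer n) : Prop :=
  CanMove P σ.points σ.sched T (fun S' => Perfect P σ.points S' σ.lev)

/-- The edges from `ℓ` to `ℓ'` of the distribution graph: the active ε-transfers from `ℓ` to `ℓ'`. -/
def distributionGraph (P : Problem n k) (σ : State n k) (ℓ ℓ' : ℕ) : Set (Transfer n) :=
  {T | IsActiveTransfer P σ T ∧ T.source = ℓ ∧ T.dest = ℓ'}

def ActiveEdge (P : Problem n k) (σ : State n k) (ℓ ℓ' : ℕ) : Prop :=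
  (distributionGraph P σ ℓ ℓ').Nonempty

/-- There is an (active or inactive) ε-transfer from `ℓ` to `ℓ'`. -/
def EpsEdge (P : Problem n k) (σ : State n k) (ℓ ℓ' : ℕ) : Prop :=
  ∃ T : Transfer n, IsEpsTransfer P σ T ∧ T.source = ℓ ∧ T.dest = ℓ'

/-- There is a path of active ε-transfers. -/
def ActivePath (P : Problem n k) (σ : State n k) : ℕ → ℕ → Prop :=
  Relation.ReflTransGen (ActiveEdge P σ)

/-- There is a path of (active or inactive) ε-transfers. -/
def EpsPath (P : Problem n k) (σ : State n k) : ℕ → ℕ → Prop :=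
  Relation.ReflTransGen (EpsEdge P σ)

/-! ## Path finding -/

/-- The edge `v → u` has at least the priority of `v' → u'`: right going edges come first, shorter
ones before longer ones; among left going edges, longer ones come before shorter ones. -/
def PriorityGE (v u v' u' : ℕ) : Prop :=
  (v < u ∧ (u' < v' ∨ u - v ≤ u' - v')) ∨ (u < v ∧ u' < v' ∧ v' - u' ≤ v - u)

/-- `PathFinding edge root V f`: starting from `{root}` one can reach the vertex set `V` by adding,
again and again, the start of an edge of highest priority that enters the current set; `f v` is the
end of the edge by which `v` was added. -/
inductive PathFinding (edge : ℕ → ℕ → Prop) (root : ℕ) : Finset ℕ → (ℕ → ℕ) → Prop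
  | start (f : ℕ → ℕ) : PathFinding edge root {root} f
  | add (V : Finset ℕ) (f : ℕ → ℕ) (v u : ℕ) : PathFinding edge root V f →
      v ∉ V → u ∈ V → edge v u →
      (∀ v' u', v' ∉ V → u' ∈ V → edge v' u' → PriorityGE v u v' u') →
      PathFinding edge root (insert v V) (Function.update f v u)

/-! ## Steps of the algorithm -/

/-- The start: the greedy schedule for the whole instance, a rate for which it is feasible, and one
speed level for every job. -/
structure Initial (P : Problem n k) (σ : State n k) : Prop where
  valid : Valid P σ
  yds : IsYDS P ∅ σ.sched
  exact_work : ∀ j, workIn P σ.sched j univ = P.volume j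
  single : ∀ j ℓ ℓ', ActiveIn P σ.points j ℓ → ActiveIn P σ.points j ℓ' → σ.lev j ℓ = σ.lev j ℓ'

/-- The rate is lowered while work is moved along the tree of active ε-transfers that path finding
chooses; every depletion interval but the rightmost one has its transfer `T ℓ` in the tree. -/
def MoveWork (P : Problem n k) (σ σ' : State n k) : Prop :=
  Valid P σ' ∧ σ'.points = σ.points ∧ σ'.lev = σ.lev ∧ σ'.rate ≤ σ.rate ∧
  ∃ f : ℕ → ℕ, PathFinding (ActiveEdge P σ) σ.last (Finset.Icc 1 σ.last) f ∧
  ∃ T : ℕ → Transfer n, (∀ ℓ ∈ Finset.Ico 1 σ.last, T ℓ ∈ distributionGraph P σ ℓ (f ℓ)) ∧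
  ∃ w : (ℓ : ℕ) → Fin ((T ℓ).len + 1) → ℝ, (∀ ℓ a, 0 ≤ w ℓ a) ∧
    ∀ j, ∀ ℓ ∈ Finset.Icc 1 σ.last, workIn P σ'.sched j (ivl σ.points ℓ) =
      workIn P σ.sched j (ivl σ.points ℓ) + ∑ ℓ' ∈ Finset.Ico 1 σ.last, (T ℓ').net (w ℓ') j ℓ

/-- The speed level of a job at a time of its window is the same in both states. -/
def SameLevels (P : Problem n k) (σ σ' : State n k) : Prop :=
  ∀ j, ∀ t ∈ P.window j, σ'.lev j (idx σ'.points t) = σ.lev j (idx σ.points t)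

/-- A deadline at which the battery is empty is labelled as a new depletion point. The work of each
old depletion interval stays in it and is rescheduled between the new depletion points. -/
def AddPoint (P : Problem n k) (σ σ' : State n k) : Prop :=
  Valid P σ' ∧ σ'.rate = σ.rate ∧ SameLevels P σ σ' ∧
  (∃ j, P.deadline j ∉ σ.points ∧ energy P σ.rate σ.sched (P.deadline j) = 0 ∧
    σ'.points = insert (P.deadline j) σ.points) ∧
  ∀ j ℓ, workIn P σ'.sched j (ivl σ.points ℓ) = workIn P σ.sched j (ivl σ.points ℓ)

/-- A depletion point is removed, which merges two depletion intervals; every job that is active in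
both must have the same level in both. The work of each new depletion interval stays in it. -/
def RemovePoint (P : Problem n k) (σ σ' : State n k) : Prop :=
  Valid P σ' ∧ σ'.rate = σ.rate ∧ SameLevels P σ σ' ∧
  (∃ τ ∈ σ.points, σ'.points = σ.points.erase τ) ∧
  ∀ j ℓ, workIn P σ'.sched j (ivl σ'.points ℓ) = workIn P σ.sched j (ivl σ'.points ℓ)

/-- `U = {lo, ..., hi}` is a cut of the distribution graph that can be fixed by changing speed
levels: for some depletion interval `ℓ₀`, no path of active ε-transfers leads to the rightmost
depletion interval, but a path of ε-transfers does; `lo` and `hi` are the minimal and the maximal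
depletion interval reachable from `ℓ₀` by active ε-transfers. -/
def IsFixableCut (P : Problem n k) (σ : State n k) (lo hi : ℕ) : Prop :=
  ∃ ℓ₀ ∈ Finset.Icc 1 σ.last, ¬ ActivePath P σ ℓ₀ σ.last ∧ EpsPath P σ ℓ₀ σ.last ∧
    IsLeast {ℓ | ActivePath P σ ℓ₀ ℓ} lo ∧ IsGreatest {ℓ | ActivePath P σ ℓ₀ ℓ} hi

/-- The speed levels of `j` are lowered by one in `U`. -/
def LoweredIn (P : Problem n k) (σ σ' : State n k) (U : Finset ℕ) (j : Fin n) : Prop :=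
  ∀ ℓ, ActiveIn P σ.points j ℓ → σ'.lev j ℓ + (if ℓ ∈ U then 1 else 0) = σ.lev j ℓ

/-- The speed levels of `j` are raised by one outside `U`. -/
def RaisedOutside (P : Problem n k) (σ σ' : State n k) (U : Finset ℕ) (j : Fin n) : Prop :=
  ∀ ℓ, ActiveIn P σ.points j ℓ → σ'.lev j ℓ = σ.lev j ℓ + (if ℓ ∈ U then 0 else 1)

/-- A cut is fixed: nothing but the speed levels changes. For every job that is active both in `U`
and outside, the levels are lowered in `U` or raised outside `U`. For the other jobs this may be
done, or the levels stay. The new levels again satisfy the speed level relation. -/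
def FixCut (P : Problem n k) (σ σ' : State n k) : Prop :=
  Valid P σ' ∧ σ'.rate = σ.rate ∧ σ'.sched = σ.sched ∧ σ'.points = σ.points ∧
  ∃ lo hi, IsFixableCut P σ lo hi ∧
    ∀ j, LoweredIn P σ σ' (Finset.Icc lo hi) j ∨ RaisedOutside P σ σ' (Finset.Icc lo hi) j ∨
      (¬ ((∃ ℓ ∈ Finset.Icc lo hi, ActiveIn P σ.points j ℓ) ∧
          (∃ ℓ, ℓ ∉ Finset.Icc lo hi ∧ ActiveIn P σ.points j ℓ)) ∧
        ∀ ℓ, ActiveIn P σ.points j ℓ → σ'.lev j ℓ = σ.lev j ℓ)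

/-- `Run P σ m`: some execution of the algorithm on `P` arrives at state `σ` after having fixed a
cut exactly `m` times. -/
inductive Run (P : Problem n k) : State n k → ℕ → Prop
  | init (σ : State n k) : Initial P σ → Run P σ 0
  | moveWork (σ σ' : State n k) (m : ℕ) : Run P σ m → MoveWork P σ σ' → Run P σ' m
  | addPoint (σ σ' : State n k) (m : ℕ) : Run P σ m → AddPoint P σ σ' → Run P σ' m
  | removePoint (σ σ' : State n k) (m : ℕ) : Run P σ m → RemovePoint P σ σ' → Run P σ' m
  | fixCut (σ σ' : State n k) (m : ℕ) : Run P σ m → FixCut P σ σ' → Run P σ' (m + 1)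

end Solar

end

/-!
A potential argument bounds the number of fixed cuts. For a deadline `τ` that lies inside the window
of some job, choose such a job once and for all, and let the *gap* at `τ` be the level of this job
at `τ` minus its level just before `τ` (for other deadlines the gap is zero). By the speed level
relation gaps lie between `0` and `k`. The potential is the sum of all gaps, where the gap at `τ` is
weighted by the rank of `τ` among the distinct deadlines, so it is at most `k * n ^ 2`
(`potential_le`).

Moving work and changing the set of depletion points leave the level of each job at each time as it
is, so they do not change the potential (`potential_eq_of_sameLevels`). Fixing a cut
`U = {lo, …, hi}` lowers the levels in `U` by one relative to those outside: the gap at the left end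
of `U` falls by one if a job crosses it, the gap at the right end of `U` rises by one, and no other
gap changes (`gap_of_fixCut`). Some job does cross the right end, because a path of transfers leads
from `U` to the rightmost depletion interval (`IsFixableCut.exists_crosses`). As the right end has
the higher rank, every fixed cut raises the potential (`potential_lt_of_fixCut`).
-/

namespace Solar

variable {n k : ℕ}

/-! ### Indices of depletion intervals -/

/-- The index of the depletion interval that contains the times just before `t`. -/
noncomputable def leftIdx (D : Finset ℝ) (t : ℝ) : ℕ := (D.filter (fun τ => τ < t)).card + 1

theorem idx_mono (D : Finset ℝ) : Monotone (idx D) := fun _ _ h =>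
  Nat.succ_le_succ (Finset.card_le_card
    (Finset.monotone_filter_right D (fun _ _ hx => le_trans hx h)))

theorem leftIdx_of_notMem {D : Finset ℝ} {t : ℝ} (h : t ∉ D) : leftIdx D t = idx D t := by
  unfold leftIdx idx
  congr 2
  refine Finset.filter_congr fun x hx => ⟨le_of_lt, fun hle => lt_of_le_of_ne hle ?_⟩
  rintro rfl
  exact h hx

theorem idx_of_mem {D : Finset ℝ} {t : ℝ} (h : t ∈ D) : idx D t = leftIdx D t + 1 := by
  have key : D.filter (fun τ => τ ≤ t) = insert t (D.filter (fun τ => τ < t)) := by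
    ext x
    simp only [Finset.mem_filter, Finset.mem_insert, le_iff_eq_or_lt]
    constructor
    · rintro ⟨hx, rfl | hlt⟩
      · exact Or.inl rfl
      · exact Or.inr ⟨hx, hlt⟩
    · rintro (rfl | ⟨hx, hlt⟩)
      · exact ⟨h, Or.inl rfl⟩
      · exact ⟨hx, Or.inr hlt⟩
  rw [idx, key, Finset.card_insert_of_notMem (by simp), leftIdx]

theorem leftIdx_le_idx (D : Finset ℝ) (t : ℝ) : leftIdx D t ≤ idx D t := by
  by_cases h : t ∈ D
  · rw [idx_of_mem h]; exact Nat.le_succ _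
  · exact (leftIdx_of_notMem h).le

theorem idx_eq_leftIdx {D : Finset ℝ} {t τ : ℝ} (ht : t < τ) (h : ∀ x ∈ D, x < τ → x ≤ t) :
    idx D t = leftIdx D τ := by
  unfold leftIdx idx
  congr 2
  exact Finset.filter_congr fun x hx => ⟨fun hle => hle.trans_lt ht, h x hx⟩

theorem exists_mem_idx_eq {D : Finset ℝ} {t : ℝ} (h : 1 < idx D t) :
    ∃ y ∈ D, y ≤ t ∧ idx D y = idx D t := by
  have hne : (D.filter (fun τ => τ ≤ t)).Nonempty := by
    rw [← Finset.card_pos]; unfold idx at h; omega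
  have hmem := Finset.mem_filter.1 (Finset.max'_mem _ hne)
  refine ⟨_, hmem.1, hmem.2, ?_⟩
  unfold idx
  congr 2
  exact Finset.filter_congr fun x hx =>
    ⟨fun hle => hle.trans hmem.2, fun hle => Finset.le_max' _ _ (Finset.mem_filter.2 ⟨hx, hle⟩)⟩

theorem exists_mem_idx_eq_leftIdx {D : Finset ℝ} {t : ℝ} (h : 1 < leftIdx D t) :
    ∃ y ∈ D, y < t ∧ idx D y = leftIdx D t := by
  have hne : (D.filter (fun τ => τ < t)).Nonempty := by
    rw [← Finset.card_pos]; unfold leftIdx at h; omega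
  have hmem := Finset.mem_filter.1 (Finset.max'_mem _ hne)
  exact ⟨_, hmem.1, hmem.2, idx_eq_leftIdx hmem.2
    fun x hx hlt => Finset.le_max' _ _ (Finset.mem_filter.2 ⟨hx, hlt⟩)⟩

/-- Between a time of index at most `m` and a time of larger index lies the right end of the
interval `I_m`. -/
theorem exists_mem_leftIdx_eq {D : Finset ℝ} {t₁ t₂ : ℝ} {m : ℕ} (hm : 1 ≤ m)
    (h₁ : idx D t₁ ≤ m) (h₂ : m < idx D t₂) : ∃ τ ∈ D, t₁ < τ ∧ τ ≤ t₂ ∧ leftIdx D τ = m := by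
  obtain ⟨y, hyD, hyt, hy⟩ := exists_mem_idx_eq (hm.trans_lt h₂)
  have hne : (D.filter (fun x => m < idx D x)).Nonempty :=
    ⟨y, Finset.mem_filter.2 ⟨hyD, hy ▸ h₂⟩⟩
  -- The right end of `I_m` is the first depletion point whose index exceeds `m`.
  obtain ⟨τ, hτ, hmin⟩ : ∃ τ ∈ D.filter (fun x => m < idx D x),
      ∀ x ∈ D.filter (fun x => m < idx D x), τ ≤ x :=
    ⟨_, Finset.min'_mem _ hne, fun x hx => Finset.min'_le _ x hx⟩
  obtain ⟨hτD, hτm⟩ := Finset.mem_filter.1 hτ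
  refine ⟨τ, hτD, (idx_mono D).reflect_lt (h₁.trans_lt hτm),
    (hmin y (Finset.mem_filter.2 ⟨hyD, hy ▸ h₂⟩)).trans hyt, le_antisymm ?_ ?_⟩
  · by_contra! hlt
    obtain ⟨x, hxD, hxτ, hx⟩ := exists_mem_idx_eq_leftIdx (hm.trans_lt hlt)
    exact absurd (hmin x (Finset.mem_filter.2 ⟨hxD, hx ▸ hlt⟩)) (not_le.2 hxτ)
  · rw [idx_of_mem hτD] at hτm
    omega

/-! ### Jobs that cross a point of time -/

/-- The window of `j` contains `τ` and some time before `τ`. -/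
def Crosses (P : Problem n k) (j : Fin n) (τ : ℝ) : Prop :=
  P.release j < τ ∧ τ < P.deadline j

namespace Crosses

variable {P : Problem n k} {j : Fin n} {τ : ℝ}

theorem mem_window (h : Crosses P j τ) : τ ∈ P.window j := ⟨h.1.le, h.2⟩

theorem exists_lt (h : Crosses P j τ) (E : Finset ℝ) :
    ∃ t ∈ P.window j, t < τ ∧ ∀ x ∈ E, x < τ → x ≤ t := by
  set F := insert (P.release j) (E.filter (fun x => x < τ)) with hF
  have hne : F.Nonempty := Finset.insert_nonempty _ _
  have hlt : F.max' hne < τ := by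
    rw [Finset.max'_lt_iff]
    intro y hy
    rcases Finset.mem_insert.1 hy with rfl | hy
    · exact h.1
    · exact (Finset.mem_filter.1 hy).2
  exact ⟨F.max' hne, ⟨F.le_max' _ (Finset.mem_insert_self _ _), hlt.trans h.2⟩, hlt,
    fun x hx hxτ => F.le_max' _ (Finset.mem_insert_of_mem (Finset.mem_filter.2 ⟨hx, hxτ⟩))⟩

theorem activeIn_idx (h : Crosses P j τ) (D : Finset ℝ) : ActiveIn P D j (idx D τ) :=
  ⟨τ, ⟨(P.release_nonneg j).trans h.1.le, rfl⟩, h.mem_window⟩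

theorem activeIn_leftIdx (h : Crosses P j τ) (D : Finset ℝ) : ActiveIn P D j (leftIdx D τ) := by
  obtain ⟨t, htw, ht, hD⟩ := h.exists_lt D
  exact ⟨t, ⟨(P.release_nonneg j).trans htw.1, idx_eq_leftIdx ht hD⟩, htw⟩

end Crosses

/-! ### Gaps of the speed levels -/

open Classical in
/-- The increase of the speed level at `τ`. It is measured on a job that crosses `τ`; the choice of
this job depends on `P` and `τ` only, so gaps in different states can be compared. The gap is zero
if no job crosses `τ`. -/
noncomputable def gap (P : Problem n k) (σ : State n k) (τ : ℝ) : ℤ :=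
  if h : ∃ j, Crosses P j τ then
    (σ.lev h.choose (idx σ.points τ) : ℤ) - σ.lev h.choose (leftIdx σ.points τ)
  else 0

theorem gap_of_not_crosses {P : Problem n k} {τ : ℝ} (h : ¬ ∃ j, Crosses P j τ) (σ : State n k) :
    gap P σ τ = 0 := dif_neg h

theorem exists_gap_eq {P : Problem n k} {τ : ℝ} (h : ∃ j, Crosses P j τ) :
    ∃ j, Crosses P j τ ∧ ∀ σ : State n k,
      gap P σ τ = (σ.lev j (idx σ.points τ) : ℤ) - σ.lev j (leftIdx σ.points τ) :=
  ⟨h.choose, h.choose_spec, fun _ => dif_pos h⟩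

theorem gap_nonneg {P : Problem n k} {σ : State n k} (hσ : Valid P σ) (τ : ℝ) :
    0 ≤ gap P σ τ := by
  by_cases h : ∃ j, Crosses P j τ
  · obtain ⟨j, hj, hgap⟩ := exists_gap_eq h
    rw [hgap]
    rcases (leftIdx_le_idx σ.points τ).eq_or_lt with heq | hlt
    · simp [heq]
    · exact (hσ.perfect.2.jump j j _ _ hlt (hj.activeIn_leftIdx _) (hj.activeIn_idx _)
        (hj.activeIn_leftIdx _) (hj.activeIn_idx _)).2
  · exact (gap_of_not_crosses h σ).ge

theorem gap_le {P : Problem n k} {σ : State n k} (hσ : Valid P σ) (τ : ℝ) : gap P σ τ ≤ k := by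
  by_cases h : ∃ j, Crosses P j τ
  · obtain ⟨j, hj, hgap⟩ := exists_gap_eq h
    have := hσ.perfect.2.range j _ (hj.activeIn_idx σ.points)
    rw [hgap]
    omega
  · simp [gap_of_not_crosses h σ]

theorem gap_eq_of_sameLevels {P : Problem n k} {σ σ' : State n k} (h : SameLevels P σ σ') (τ : ℝ) :
    gap P σ' τ = gap P σ τ := by
  by_cases hc : ∃ j, Crosses P j τ
  · obtain ⟨j, hj, hgap⟩ := exists_gap_eq hc
    -- A time so close to `τ` that no old or new depletion point lies strictly between them.
    obtain ⟨t, htw, ht, hE⟩ := hj.exists_lt (σ.points ∪ σ'.points)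
    have h₁ := h j t htw
    rw [idx_eq_leftIdx ht fun x hx => hE x (Finset.mem_union_left _ hx),
      idx_eq_leftIdx ht fun x hx => hE x (Finset.mem_union_right _ hx)] at h₁
    rw [hgap, hgap, h₁, h j τ hj.mem_window]
  · rw [gap_of_not_crosses hc, gap_of_not_crosses hc]

open Classical in
/-- If the levels in `U` fall by one relative to the levels outside, then a gap rises by one where
`U` is left and falls by one where `U` is entered. -/
theorem gap_of_fixCut {P : Problem n k} {σ σ' : State n k} {U : Finset ℕ}
    (hD : σ'.points = σ.points)
    (h : ∀ j, LoweredIn P σ σ' U j ∨ RaisedOutside P σ σ' U j ∨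
      (¬ ((∃ ℓ ∈ U, ActiveIn P σ.points j ℓ) ∧ (∃ ℓ, ℓ ∉ U ∧ ActiveIn P σ.points j ℓ)) ∧
        ∀ ℓ, ActiveIn P σ.points j ℓ → σ'.lev j ℓ = σ.lev j ℓ)) (τ : ℝ) :
    gap P σ' τ = gap P σ τ + if ∃ j, Crosses P j τ then
      (if leftIdx σ.points τ ∈ U then 1 else 0) - (if idx σ.points τ ∈ U then 1 else 0) else 0 := by
  by_cases hc : ∃ j, Crosses P j τ
  · obtain ⟨j, hj, hgap⟩ := exists_gap_eq hc
    rw [if_pos hc, hgap, hgap, hD]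
    have hr := hj.activeIn_idx σ.points
    have hl := hj.activeIn_leftIdx σ.points
    rcases h j with h | h | ⟨hU, h⟩
    · have h₁ := h _ hr
      have h₂ := h _ hl
      split_ifs at * <;> omega
    · have h₁ := h _ hr
      have h₂ := h _ hl
      split_ifs at * <;> omega
    · have h₁ := h _ hr
      have h₂ := h _ hl
      split_ifs with hlU hrU hrU
      · omega
      · exact absurd ⟨⟨_, hlU, hl⟩, ⟨_, hrU, hr⟩⟩ hU
      · exact absurd ⟨⟨_, hrU, hr⟩, ⟨_, hlU, hl⟩⟩ hU
      · omega
  · rw [gap_of_not_crosses hc, gap_of_not_crosses hc, if_neg hc, add_zero]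

/-! ### Transfers that leave a cut -/

theorem EpsEdge.exists_activeIn {P : Problem n k} {σ : State n k} {ℓ ℓ' m : ℕ}
    (h : EpsEdge P σ ℓ ℓ') (hℓ : ℓ ≤ m) (hℓ' : m < ℓ') :
    ∃ j ℓ₁ ℓ₂, ℓ₁ ≤ m ∧ m < ℓ₂ ∧ ActiveIn P σ.points j ℓ₁ ∧ ActiveIn P σ.points j ℓ₂ := by
  obtain ⟨T, ⟨-, hT, -⟩, rfl, rfl⟩ := h
  by_contra! hno
  have hall : ∀ a : Fin (T.len + 2), T.interval a ≤ m := by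
    intro a
    induction a using Fin.induction with
    | zero => exact hℓ
    | succ a ih =>
      by_contra! hlt
      exact hno _ _ _ ih hlt (hT a).2.1 (hT a).2.2
  exact absurd (hall (Fin.last _)) (not_le.2 hℓ')

theorem EpsPath.exists_activeIn {P : Problem n k} {σ : State n k} {ℓ ℓ' m : ℕ}
    (h : EpsPath P σ ℓ ℓ') (hℓ : ℓ ≤ m) (hℓ' : m < ℓ') :
    ∃ j ℓ₁ ℓ₂, ℓ₁ ≤ m ∧ m < ℓ₂ ∧ ActiveIn P σ.points j ℓ₁ ∧ ActiveIn P σ.points j ℓ₂ := by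
  induction h with
  | refl => exact absurd hℓ (not_le.2 hℓ')
  | @tail b c _ hbc ih =>
    by_cases hb : b ≤ m
    · exact hbc.exists_activeIn hb hℓ'
    · exact ih (not_le.1 hb)

theorem ActivePath.mem_Icc {P : Problem n k} {σ : State n k} {ℓ ℓ' : ℕ}
    (h : ActivePath P σ ℓ ℓ') (hℓ : ℓ ∈ Finset.Icc 1 σ.last) : ℓ' ∈ Finset.Icc 1 σ.last := by
  induction h with
  | refl => exact hℓ
  | tail _ hbc _ =>
    obtain ⟨T, ⟨hT, -⟩, -, rfl⟩ := hbc
    exact hT (Fin.last _)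

theorem IsFixableCut.exists_crosses {P : Problem n k} {σ : State n k} {lo hi : ℕ}
    (h : IsFixableCut P σ lo hi) :
    lo ≤ hi ∧ ∃ τ ∈ σ.points, leftIdx σ.points τ = hi ∧ ∃ j, Crosses P j τ := by
  obtain ⟨ℓ₀, hℓ₀, hno, heps, hlo, hhi⟩ := h
  have hhi' := Finset.mem_Icc.1 (ActivePath.mem_Icc hhi.1 hℓ₀)
  have hlast : hi < σ.last := lt_of_le_of_ne hhi'.2 fun heq => hno (heq ▸ hhi.1)
  obtain ⟨j, _, _, h₁, h₂, ⟨t₁, ⟨-, rfl⟩, ht₁⟩, ⟨t₂, ⟨-, rfl⟩, ht₂⟩⟩ :=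
    heps.exists_activeIn (hhi.2 Relation.ReflTransGen.refl) hlast
  obtain ⟨τ, hτ, h₁τ, hτ₂, hidx⟩ := exists_mem_leftIdx_eq hhi'.1 h₁ h₂
  exact ⟨hlo.2 hhi.1, τ, hτ, hidx, j, ht₁.1.trans_lt h₁τ, hτ₂.trans_lt ht₂.2⟩

/-! ### The potential -/

/-- The set of all deadlines. -/
noncomputable def Problem.deadlines (P : Problem n k) : Finset ℝ := Finset.univ.image P.deadline

/-- The number of distinct deadlines up to `τ`. -/
noncomputable def Problem.rank (P : Problem n k) (τ : ℝ) : ℕ :=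
  (P.deadlines.filter (fun x => x ≤ τ)).card

theorem Problem.card_deadlines_le (P : Problem n k) : P.deadlines.card ≤ n :=
  Finset.card_image_le.trans_eq (by simp)

theorem Problem.rank_le (P : Problem n k) (τ : ℝ) : P.rank τ ≤ n :=
  (Finset.card_filter_le _ _).trans P.card_deadlines_le

theorem Problem.rank_lt_rank (P : Problem n k) {τ τ' : ℝ} (h : τ < τ') (hτ' : τ' ∈ P.deadlines) :
    P.rank τ < P.rank τ' := by
  refine Finset.card_lt_card (Finset.ssubset_iff_of_subset ?_ |>.2 ⟨τ', ?_, ?_⟩)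
  · exact Finset.monotone_filter_right _ (fun _ _ hx => le_trans hx h.le)
  · exact Finset.mem_filter.2 ⟨hτ', le_rfl⟩
  · simp [h]

theorem Problem.rank_pos (P : Problem n k) {τ : ℝ} (hτ : τ ∈ P.deadlines) : 0 < P.rank τ :=
  Finset.card_pos.2 ⟨τ, Finset.mem_filter.2 ⟨hτ, le_rfl⟩⟩

/-- The sum of the gaps at all deadlines, weighted by their ranks. -/
noncomputable def potential (P : Problem n k) (σ : State n k) : ℤ :=
  ∑ τ ∈ P.deadlines, P.rank τ * gap P σ τ

theorem potential_nonneg {P : Problem n k} {σ : State n k} (hσ : Valid P σ) :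
    0 ≤ potential P σ :=
  Finset.sum_nonneg fun τ _ => mul_nonneg (Nat.cast_nonneg _) (gap_nonneg hσ τ)

theorem potential_le {P : Problem n k} {σ : State n k} (hσ : Valid P σ) :
    potential P σ ≤ k * n ^ 2 := by
  have hterm : ∀ τ ∈ P.deadlines, (P.rank τ : ℤ) * gap P σ τ ≤ n * k := fun τ _ =>
    mul_le_mul (Nat.cast_le.2 (P.rank_le τ)) (gap_le hσ τ) (gap_nonneg hσ τ) (Nat.cast_nonneg _)
  calc potential P σ ≤ P.deadlines.card • ((n : ℤ) * k) := Finset.sum_le_card_nsmul _ _ _ hterm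
    _ = (P.deadlines.card : ℤ) * (n * k) := nsmul_eq_mul _ _
    _ ≤ n * (n * k) :=
      mul_le_mul_of_nonneg_right (Nat.cast_le.2 P.card_deadlines_le) (by positivity)
    _ = k * n ^ 2 := by ring

theorem potential_eq_of_sameLevels {P : Problem n k} {σ σ' : State n k} (h : SameLevels P σ σ') :
    potential P σ' = potential P σ :=
  Finset.sum_congr rfl fun τ _ => by rw [gap_eq_of_sameLevels h]

theorem potential_lt_of_fixCut {P : Problem n k} {σ σ' : State n k} (hσ : Valid P σ)
    (h : FixCut P σ σ') : potential P σ < potential P σ' := by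
  classical
  obtain ⟨-, -, -, hD, lo, hi, hcut, hlev⟩ := h
  obtain ⟨hle, τ, hτD, hτ, hτc⟩ := hcut.exists_crosses
  have hdead : ∀ x ∈ σ.points, x ∈ P.deadlines := fun x hx =>
    let ⟨j, hj⟩ := hσ.deadlines x hx
    Finset.mem_image.2 ⟨j, Finset.mem_univ j, hj⟩
  have hτT := hdead τ hτD
  have hτidx : idx σ.points τ = hi + 1 := by rw [idx_of_mem hτD, hτ]
  set δ : ℝ → ℤ := fun x => if ∃ j, Crosses P j x then
      (if leftIdx σ.points x ∈ Finset.Icc lo hi then 1 else 0) -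
        (if idx σ.points x ∈ Finset.Icc lo hi then 1 else 0) else 0 with hδ
  have hsum : potential P σ' = potential P σ + ∑ x ∈ P.deadlines, P.rank x * δ x := by
    unfold potential
    rw [← Finset.sum_add_distrib]
    exact Finset.sum_congr rfl fun x _ => by rw [gap_of_fixCut hD hlev x, mul_add]
  have hδτ : δ τ = 1 := by
    simp only [hδ, if_pos hτc, hτ, hτidx, Finset.mem_Icc]
    simp [hle]
  have hge : ∀ x, -1 ≤ δ x := fun x => by
    simp only [hδ]; split_ifs <;> norm_num
  have hneg : ∀ x, δ x < 0 → x ∈ σ.points ∧ idx σ.points x = lo := fun x hx => by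
    have hmem : x ∈ σ.points := by
      by_contra hx'
      simp [hδ, leftIdx_of_notMem hx'] at hx
    refine ⟨hmem, ?_⟩
    have hidx := idx_of_mem hmem
    simp only [hδ, Finset.mem_Icc] at hx
    split_ifs at hx <;> omega
  have hpos : 0 < ∑ x ∈ P.deadlines, (P.rank x : ℤ) * δ x := by
    by_cases hex : ∃ x, δ x < 0
    · obtain ⟨x, hx⟩ := hex
      obtain ⟨hxD, hxlo⟩ := hneg x hx
      have hxτ : x < τ := (idx_mono σ.points).reflect_lt (by omega)
      have hrank : (P.rank x : ℤ) < P.rank τ := Nat.cast_lt.2 (P.rank_lt_rank hxτ hτT)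
      -- The left end of the cut is the only point where a gap falls.
      have huniq : ∀ y, δ y < 0 → y = x := fun y hy => by
        obtain ⟨hyD, hylo⟩ := hneg y hy
        have hstep : ∀ a b, b ∈ σ.points → a < b → idx σ.points a < idx σ.points b := by
          intro a b hb hab
          rw [idx_of_mem hb]
          exact Nat.lt_succ_of_le (Nat.succ_le_succ (Finset.card_le_card
            (Finset.monotone_filter_right _ (fun _ _ hz => lt_of_le_of_lt hz hab))))
        rcases lt_trichotomy y x with hlt | heq | hlt
        · have := hstep _ _ hxD hlt; omega
        · exact heq
        · have := hstep _ _ hyD hlt; omega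
      calc (0 : ℤ) < P.rank τ * δ τ + P.rank x * δ x := by
            have : -(P.rank x : ℤ) ≤ P.rank x * δ x := by
              have := mul_le_mul_of_nonneg_left (hge x) (Nat.cast_nonneg (α := ℤ) (P.rank x))
              linarith
            rw [hδτ]; linarith
        _ = ∑ y ∈ {τ, x}, (P.rank y : ℤ) * δ y := by rw [Finset.sum_pair hxτ.ne']
        _ ≤ _ := by
            refine Finset.sum_le_sum_of_subset_of_nonneg ?_ fun y _ hy => ?_
            · intro y hy
              rcases Finset.mem_insert.1 hy with rfl | hy
              · exact hτT
              · exact Finset.mem_singleton.1 hy ▸ hdead x hxD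
            · refine mul_nonneg (Nat.cast_nonneg _) (not_lt.1 fun hlt => hy ?_)
              simp [huniq y hlt]
    · push Not at hex
      have hrank := P.rank_pos hτT
      calc (0 : ℤ) < P.rank τ * δ τ := by rw [hδτ]; omega
        _ ≤ _ := Finset.single_le_sum (f := fun y => (P.rank y : ℤ) * δ y)
            (fun y _ => mul_nonneg (Nat.cast_nonneg _) (hex y)) hτT
  omega

theorem Run.le_potential {P : Problem n k} {σ : State n k} {m : ℕ} (h : Run P σ m) :
    Valid P σ ∧ (m : ℤ) ≤ potential P σ := by
  induction h with
  | init σ h => exact ⟨h.valid, by simpa using potential_nonneg h.valid⟩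
  | moveWork σ σ' m _ h ih =>
    obtain ⟨hv, hD, hlev, -⟩ := h
    have hs : SameLevels P σ σ' := fun j t _ => by rw [hD, hlev]
    exact ⟨hv, (potential_eq_of_sameLevels hs).symm ▸ ih.2⟩
  | addPoint σ σ' m _ h ih => exact ⟨h.1, (potential_eq_of_sameLevels h.2.2.1).symm ▸ ih.2⟩
  | removePoint σ σ' m _ h ih => exact ⟨h.1, (potential_eq_of_sameLevels h.2.2.1).symm ▸ ih.2⟩
  | fixCut σ σ' m _ h ih =>
    have := potential_lt_of_fixCut ih.1 h
    exact ⟨h.1, by push_cast; linarith [ih.2]⟩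

end Solar

theorem mainTheorem5 {n k : ℕ} (P : Solar.Problem n k) (σ : Solar.State n k) (m : ℕ)
    (h : Solar.Run P σ m) : m ≤ k * n ^ 2 := by
  obtain ⟨hσ, hm⟩ := h.le_potential
  exact_mod_cast hm.trans (Solar.potential_le hσ)
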